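/- For positive integers $r,s,n$ put $\sigma_r(n)=\sum_{d\mid n}d^r$, set $\sigma_r(x)=0$ if $x$ is not a positive integer, and write $\sigma=\sigma_1$. For positive integers $a,b$ let $$W^{r,s}_{a,b}(n)=\sum_{\substack{l,m\ge 1\\ al+bm=n}}\sigma_r(l)\,\sigma_s(m).$$ Let $M_w(N)$ be the finite-dimensional complex vector space of holomorphic modular forms of weight $w$ on $\Gamma_0(N)$ (trivial character), let $\lambda_w(N)$ be its dimension, and let $B_k$ be the $k$-th Bernoulli number. Theorem. Let $k\ge 4$ be an even integer and let $a,b$ be positive integers with $\gcd(a,b)=1$. Let $f_i$ $(1\le i\le\lambda_{k+2}(ab))$ be a basis of $M_{k+2}(ab)$ and $h_i$ $(1\le i\le\lambda_{k+4}(ab))$ a basis of $M_{k+4}(ab)$, and let $a_i(n)$ and $c_i(n)$ denote the $n$-th Fourier coefficients of $f_i$ and $h_i$, respectively (the coefficients of $q^n$, $q=e^{2\pi i z}$). Then there exist constants $\gamma_i\in\mathbb{C}$ $(1\le i\le\lambda_{k+4}(ab))$, independent of $n$, such that for all $n\ge 2$ $$\sum_{\substack{l,m\ge 1\\ al+bm=n}}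 l\,\sigma(l)\,\sigma_{k-1}(m)=\frac{6n^2-a(k+1)n}{12a^2(k+1)(k+2)}\,\sigma_{k-1}(n/b)+\frac{B_k}{2a(k+2)}\,n\,\sigma(n/a)+\frac{2n}{a(k+2)}\,W^{1,k-1}_{a,b}(n)+\frac{B_k}{4a^2k(k+1)(k+2)}\sum_{i=1}^{\lambda_{k+4}(ab)}\gamma_i\,c_i(n).$$ Here $W^{1,k-1}_{a,b}(n)$ is given as follows: there exist constants $\alpha_i\in\mathbb{C}$ $(1\le i\le\lambda_{k+2}(ab))$, independent of $n$, such that for all $n\ge 1$ $$W^{1,k-1}_{a,b}(n)=\frac{B_k}{2k}\,\sigma(n/a)+\Big(\frac1{24}-\frac{n}{2ka}\Big)\sigma_{k-1}(n/b)-\frac{B_k}{4ak^2}\sum_{i=1}^{\lambda_{k+2}(ab)}\alpha_i\,a_i(n).$$ -/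

import Mathlib

open scoped MatrixGroups

noncomputable section

/-- The space `M_k(N)` of holomorphic modular forms of integral weight `k` on `Γ₀(N)`
(with trivial character), as a complex vector space. -/
abbrev ModForms (k : ℤ) (N : ℕ) : Type :=
  ModularForm (CongruenceSubgroup.Gamma0 N : Subgroup (GL (Fin 2) ℝ)) k

/-- The dimension `λ_k(N)` of `M_k(N)` over `ℂ`. -/
def dimModForms (k : ℤ) (N : ℕ) : ℕ := Module.finrank ℂ (ModForms k N)

/-- The `n`-th Fourier coefficient of `f ∈ M_k(N)`, i.e. the coefficient of `q ^ n` in the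
expansion of `f` in powers of `q = exp (2 π i z)`. -/
def modFormCoeff {k : ℤ} {N : ℕ} (f : ModForms k N) (n : ℕ) : ℂ :=
  (UpperHalfPlane.qExpansion 1 f).coeff n

/-- `sigmaDiv r n a` is `σ_r(n/a)`, with the convention that it is `0` if `n/a` is not a
positive integer (Mathlib's `σ_r` vanishes at `0`). -/
def sigmaDiv (r n a : ℕ) : ℕ :=
  if a ∣ n then ArithmeticFunction.sigma r (n / a) else 0

/-- The pairs of positive integers `(l, m)` with `a l + b m = n` (for `a, b` positive, every such
pair has `l, m ≤ n`). -/
def convPairs (a b n : ℕ) : Finset (ℕ × ℕ) :=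
  (Finset.Icc 1 n ×ˢ Finset.Icc 1 n).filter fun p => a * p.1 + b * p.2 = n

/-- The convolution sum `W_{a,b}^{r,s}(n) = ∑_{a l + b m = n} σ_r(l) σ_s(m)`. -/
def convW (a b r s n : ℕ) : ℕ :=
  ∑ p ∈ convPairs a b n, ArithmeticFunction.sigma r p.1 * ArithmeticFunction.sigma s p.2

/-- The convolution sum `W_{a,b}^{e;r,s}(n) = ∑_{a l + b m = n} l ^ e σ_r(l) σ_s(m)`. -/
def convWPow (a b e r s n : ℕ) : ℕ :=
  ∑ p ∈ convPairs a b n,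
    p.1 ^ e * ArithmeticFunction.sigma r p.1 * ArithmeticFunction.sigma s p.2

/-- For positive `a` and `b`, `convPairs a b n` consists of all the pairs of positive integers
`(l, m)` with `a l + b m = n`. -/
theorem mem_convPairs {a b n : ℕ} (ha : 0 < a) (hb : 0 < b) (p : ℕ × ℕ) :
    p ∈ convPairs a b n ↔ 0 < p.1 ∧ 0 < p.2 ∧ a * p.1 + b * p.2 = n := by
  simp only [convPairs, Finset.mem_filter, Finset.mem_product, Finset.mem_Icc]
  constructor
  · rintro ⟨⟨⟨h1, -⟩, h2, -⟩, h⟩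
    exact ⟨h1, h2, h⟩
  · rintro ⟨h1, h2, h⟩
    have h3 := Nat.le_mul_of_pos_left p.1 ha
    have h4 := Nat.le_mul_of_pos_left p.2 hb
    exact ⟨⟨⟨h1, by omega⟩, h2, by omega⟩, h⟩

end

/-!
The function `φ(z) = a E₂(az)` transforms under `Γ₀(N)`, `a ∣ N`, with the same error term as `E₂`,
so `φ - E₂` is modular of weight `2`. Let `g(z) = E_k(bz)`, `b ∣ N`, and `D = q d/dq`. Then
`φ g - (12/k) D g = (φ - E₂) g - (12/k) (D g - (k/12) E₂ g)` is modular of weight `k + 2`, and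
`(k+1)(k+2) (D φ) g - 2(k+1) D(φ g) + 12 D² g` is modular of weight `k + 4`: it is the sum of a
multiple of the Rankin–Cohen bracket `[φ - E₂, g]` and of the Kaneko–Zagier operator
`12 D² g - 2(k+1) E₂ D g + k(k+1) (D E₂) g`. The coefficients of `φ g` and `(D φ) g` involve the
convolution sums `∑ σ(l) σ_{k-1}(m)` and `∑ l σ(l) σ_{k-1}(m)`, which can be solved for.
-/

section QExpansions

open UpperHalfPlane hiding I
open Complex Derivative PowerSeries
open scoped Manifold Topology Real

/-- `F` is the sum of the convergent series `∑ pₙ qⁿ`, `q = exp (2 π i τ)`, on the whole upper half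
plane. -/
def HasQExpansion (F : ℍ → ℂ) (p : ℂ⟦X⟧) : Prop :=
  ∀ τ : ℍ, HasSum (fun n ↦ p.coeff n * Function.Periodic.qParam 1 τ ^ n) (F τ)

theorem coeff_X_mul_derivative (p : ℂ⟦X⟧) (n : ℕ) :
    (X * d⁄dX ℂ p).coeff n = n * p.coeff n := by
  cases n with
  | zero => simp
  | succ n => simp [coeff_succ_X_mul, coeff_derivative, mul_comm]

theorem hasDerivAt_qParam_one_pow (n : ℕ) (w : ℂ) :
    HasDerivAt (fun w ↦ Function.Periodic.qParam 1 w ^ n)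
      (2 * π * I * (n * Function.Periodic.qParam 1 w ^ n)) w := by
  have h := ((hasDerivAt_id w).const_mul (n * (2 * π * I))).cexp
  have hexp (w : ℂ) : Function.Periodic.qParam 1 w ^ n = exp (n * (2 * π * I) * id w) := by
    simp [Function.Periodic.qParam, ← exp_nat_mul, mul_assoc]
  simp only [hexp]
  convert! h using 1
  ring

namespace HasQExpansion

variable {F G : ℍ → ℂ} {p q : ℂ⟦X⟧}

theorem add (hF : HasQExpansion F p) (hG : HasQExpansion G q) :
    HasQExpansion (F + G) (p + q) := fun τ ↦ by
  simpa [add_mul] using (hF τ).add (hG τ)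

theorem const_smul (c : ℂ) (hF : HasQExpansion F p) : HasQExpansion (c • F) (c • p) := fun τ ↦ by
  simpa [mul_assoc] using (hF τ).mul_left c

theorem mul (hF : HasQExpansion F p) (hG : HasQExpansion G q) :
    HasQExpansion (F * G) (p * q) := fun τ ↦ by
  have hcauchy := tsum_mul_tsum_eq_tsum_sum_antidiagonal_of_summable_norm
    (hF τ).summable.norm (hG τ).summable.norm
  have hsum := (summable_norm_sum_mul_antidiagonal_of_summable_norm
    (hF τ).summable.norm (hG τ).summable.norm).of_norm.hasSum
  rw [← hcauchy, (hF τ).tsum_eq, (hG τ).tsum_eq] at hsum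
  convert! hsum using 2 with n
  rw [coeff_mul, Finset.sum_mul]
  refine Finset.sum_congr rfl fun ij hij ↦ ?_
  rw [← Finset.HasAntidiagonal.mem_antidiagonal.mp hij, pow_add]
  ring

/-- On `{w | y ≤ Im w}` the series is dominated by its absolutely convergent value at `i y`, so it
may be differentiated term by term. -/
theorem hasSum_deriv (hF : HasQExpansion F p) (τ : ℍ) :
    HasSum (fun n ↦ deriv (fun w ↦ p.coeff n * Function.Periodic.qParam 1 w ^ n) τ)
      (deriv (F ∘ ofComplex) τ) := by
  obtain ⟨y, hy, hyτ⟩ := exists_between τ.im_pos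
  let τ₀ : ℍ := ⟨y * I, by simpa using hy⟩
  have hdom (n : ℕ) (w : ℂ) (hw : w ∈ {w : ℂ | y < w.im}) :
      ‖p.coeff n * Function.Periodic.qParam 1 w ^ n‖ ≤
        ‖p.coeff n * Function.Periodic.qParam 1 τ₀ ^ n‖ := by
    have him : (τ₀ : ℂ).im ≤ w.im := by simpa [τ₀] using hw.le
    simp only [norm_mul, norm_pow, Function.Periodic.norm_qParam]
    gcongr ?_ * Real.exp (?_ / 1) ^ n
    exact mul_le_mul_of_nonpos_left him (by linarith [Real.pi_pos])
  have hdiff (n : ℕ) : Differentiable ℂ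
      (fun w ↦ p.coeff n * Function.Periodic.qParam 1 w ^ n) := fun w ↦
    ((hasDerivAt_qParam_one_pow n w).const_mul _).differentiableAt
  have hsum := hasSum_deriv_of_summable_norm (hF τ₀).summable.norm
    (fun n ↦ (hdiff n).differentiableOn) (isOpen_lt continuous_const continuous_im) hdom hyτ
  have hF' : (fun w ↦ ∑' n, p.coeff n * Function.Periodic.qParam 1 w ^ n) =ᶠ[𝓝 (τ : ℂ)]
      F ∘ ofComplex := by
    filter_upwards [isOpen_upperHalfPlaneSet.mem_nhds τ.im_pos] with w hw
    simpa [ofComplex_apply_of_im_pos hw] using (hF ⟨w, hw⟩).tsum_eq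
  rwa [hF'.deriv_eq] at hsum

theorem normalizedDeriv (hF : HasQExpansion F p) :
    HasQExpansion (D F) (X * d⁄dX ℂ p) := fun τ ↦ by
  convert! (hF.hasSum_deriv τ).mul_left (2 * π * I)⁻¹ using 2 with n
  rw [((hasDerivAt_qParam_one_pow n τ).const_mul _).deriv, coeff_X_mul_derivative]
  field_simp [two_pi_I_ne_zero]

end HasQExpansion

theorem isBoundedAtImInfty_normalizedDeriv {F : ℍ → ℂ} (hF : MDiff F)
    (hb : IsBoundedAtImInfty F) : IsBoundedAtImInfty (D F) := by
  rw [isBoundedAtImInfty_iff] at hb ⊢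
  obtain ⟨M, A, hM⟩ := hb
  refine ⟨‖(2 * π * I : ℂ)⁻¹‖ * (M / 1), max A 0 + 2, fun z hz ↦ ?_⟩
  have him (w : ℂ) (hw : w ∈ Metric.closedBall (z : ℂ) 1) : max A 0 < w.im := by
    have := (abs_le.mp ((abs_im_le_norm _).trans (mem_closedBall_iff_norm.mp hw))).1
    simp only [sub_im, coe_im] at this
    linarith
  have hpos (w : ℂ) (hw : w ∈ Metric.closedBall (z : ℂ) 1) : 0 < w.im :=
    (le_max_right _ _).trans_lt (him w hw)
  have hdiff : DiffContOnCl ℂ (F ∘ ofComplex) (Metric.ball z 1) := by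
    refine ((UpperHalfPlane.mdifferentiable_iff.mp hF).mono ?_).diffContOnCl
    rwa [closure_ball _ one_ne_zero]
  have hbound (w : ℂ) (hw : w ∈ Metric.sphere (z : ℂ) 1) : ‖(F ∘ ofComplex) w‖ ≤ M := by
    have hw' := Metric.sphere_subset_closedBall hw
    rw [Function.comp_apply, ofComplex_apply_of_im_pos (hpos w hw')]
    exact hM _ ((le_max_left _ _).trans (him w hw').le)
  rw [normalizedDerivOfComplex, norm_mul]
  gcongr
  exact norm_deriv_le_of_forall_mem_sphere_norm_le one_pos hdiff hbound

end QExpansions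

section ModularForms

open UpperHalfPlane hiding I
open Complex Derivative Matrix CongruenceSubgroup
open scoped Manifold ModularForm

/-- `F` is a holomorphic modular form of weight `k` on the subgroup `Γ` of `SL(2, ℤ)`. Being
unbundled, it keeps the weight of a product or of a derivative out of the types; the cusp condition
ranges over `SL(2, ℤ)`, which reaches every cusp when `Γ` has finite index. -/
structure IsModularForm (Γ : Subgroup SL(2, ℤ)) (k : ℤ) (F : ℍ → ℂ) : Prop where
  holo : MDiff F
  slash_eq : ∀ γ ∈ Γ, F ∣[k] γ = F
  bdd : ∀ γ : SL(2, ℤ), IsBoundedAtImInfty (F ∣[k] γ)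

theorem serreDerivative_eq_add_smul (c : ℂ) (F : ℍ → ℂ) :
    serreDerivative c F = D F + (-(c * 12⁻¹)) • (EisensteinSeries.E2 * F) := by
  ext z
  simp only [serreDerivative_apply, Pi.add_apply, Pi.smul_apply, Pi.mul_apply, smul_eq_mul]
  ring

theorem isBoundedAtImInfty_serreDerivative (c : ℂ) {F : ℍ → ℂ} (hF : MDiff F)
    (hb : IsBoundedAtImInfty F) : IsBoundedAtImInfty (serreDerivative c F) := by
  rw [serreDerivative_eq_add_smul]
  exact (isBoundedAtImInfty_normalizedDeriv hF hb).add
    ((EisensteinSeries.isBoundedAtImInfty_E2.mul hb).const_smul_left _)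

namespace IsModularForm

variable {Γ Γ' : Subgroup SL(2, ℤ)} {k l : ℤ} {F G : ℍ → ℂ}

/-- The bundled modular form with underlying function `F`. -/
def toModularForm [Γ.FiniteIndex] (hF : IsModularForm Γ k F) :
    ModularForm (Γ : Subgroup (GL (Fin 2) ℝ)) k where
  toFun := F
  slash_action_eq' := by
    rintro _ ⟨γ, hγ, rfl⟩
    exact hF.slash_eq γ hγ
  holo' := hF.holo
  bdd_at_cusps' {c} hc := by
    rw [Subgroup.IsArithmetic.isCusp_iff_isCusp_SL2Z] at hc
    exact (OnePoint.isBoundedAt_iff_forall_SL2Z hc).mpr fun γ _ ↦ hF.bdd γ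

theorem of_levelOne (f : ModularForm 𝒮ℒ k) : IsModularForm Γ k f :=
  have hslash (γ : SL(2, ℤ)) : (f : ℍ → ℂ) ∣[k] γ = f := f.slash_action_eq' _ ⟨γ, rfl⟩
  ⟨f.holo', fun γ _ ↦ hslash γ, fun γ ↦ by
    simpa only [hslash] using ModularFormClass.bdd_at_infty f⟩

theorem mono (hΓ : Γ' ≤ Γ) (hF : IsModularForm Γ k F) : IsModularForm Γ' k F :=
  ⟨hF.holo, fun γ hγ ↦ hF.slash_eq γ (hΓ hγ), hF.bdd⟩

theorem add (hF : IsModularForm Γ k F) (hG : IsModularForm Γ k G) : IsModularForm Γ k (F + G) where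
  holo := hF.holo.add hG.holo
  slash_eq γ hγ := by rw [SlashAction.add_slash, hF.slash_eq γ hγ, hG.slash_eq γ hγ]
  bdd γ := by
    rw [SlashAction.add_slash]
    exact (hF.bdd γ).add (hG.bdd γ)

theorem const_smul (c : ℂ) (hF : IsModularForm Γ k F) : IsModularForm Γ k (c • F) where
  holo := hF.holo.const_smul c
  slash_eq γ hγ := by rw [ModularForm.SL_smul_slash, hF.slash_eq γ hγ]
  bdd γ := by
    rw [ModularForm.SL_smul_slash]
    exact (hF.bdd γ).const_smul_left c

theorem mul (hF : IsModularForm Γ k F) (hG : IsModularForm Γ l G) :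
    IsModularForm Γ (k + l) (F * G) where
  holo := hF.holo.mul hG.holo
  slash_eq γ hγ := by rw [ModularForm.mul_slash_SL2, hF.slash_eq γ hγ, hG.slash_eq γ hγ]
  bdd γ := by
    rw [ModularForm.mul_slash_SL2]
    exact (hF.bdd γ).mul (hG.bdd γ)

theorem serreDerivative (hF : IsModularForm Γ k F) :
    IsModularForm Γ (k + 2) (serreDerivative k F) where
  holo := serreDerivative_mdifferentiable _ hF.holo
  slash_eq γ hγ := serreDerivative_slash_invariant hF.holo (hF.slash_eq γ hγ)
  bdd γ := by
    rw [serreDerivative_slash_equivariant hF.holo]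
    exact isBoundedAtImInfty_serreDerivative _ (hF.holo.slash k _) (hF.bdd γ)

end IsModularForm

theorem Gamma0_le_of_dvd {M N : ℕ} (hMN : M ∣ N) : Gamma0 N ≤ Gamma0 M := fun γ hγ ↦ by
  rw [Gamma0_mem, ZMod.intCast_zmod_eq_zero_iff_dvd] at hγ ⊢
  exact (Int.natCast_dvd_natCast.mpr hMN).trans hγ

theorem isBoundedAtImInfty_slash_map_ratCast {k : ℤ} {F : ℍ → ℂ}
    (hF : ∀ γ : SL(2, ℤ), IsBoundedAtImInfty (F ∣[k] γ)) (g : GL (Fin 2) ℚ) :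
    IsBoundedAtImInfty (F ∣[k] g.map (Rat.castHom ℝ)) := by
  have hcusp : IsCusp (g.map (Rat.castHom ℝ) • (OnePoint.infty : OnePoint ℝ)) 𝒮ℒ := by
    rw [isCusp_SL2Z_iff]
    refine ⟨g • OnePoint.infty, ?_⟩
    rw [← Rat.coe_castHom, OnePoint.map_smul, OnePoint.map_infty]
  exact (OnePoint.isBoundedAt_iff_forall_SL2Z hcusp).mpr (fun γ _ ↦ hF γ) _ rfl

/-- The matrix `diag(a, 1)`, acting on the upper half plane by `z ↦ a z`. -/
def scaleGL (K : Type*) [Field K] [CharZero K] (a : ℕ) [NeZero a] : GL (Fin 2) K :=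
  GeneralLinearGroup.mkOfDetNeZero !![(a : K), 0; 0, 1] (by simp [NeZero.ne])

/-- The function `z ↦ F (a z)`. -/
noncomputable def dilate (a : ℕ) [NeZero a] (F : ℍ → ℂ) (τ : ℍ) : ℂ := F (scaleGL ℝ a • τ)

section Dilation

variable {a : ℕ} [NeZero a]

theorem coe_scaleGL (K : Type*) [Field K] [CharZero K] :
    (scaleGL K a).val = !![(a : K), 0; 0, 1] := rfl

theorem det_scaleGL : (scaleGL ℝ a).det.val = a := by
  simp [coe_scaleGL]

theorem det_scaleGL_pos : 0 < (scaleGL ℝ a).det.val := by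
  rw [det_scaleGL]
  exact_mod_cast NeZero.pos a

theorem coe_scaleGL_smul (τ : ℍ) : ((scaleGL ℝ a • τ : ℍ) : ℂ) = a * τ := by
  rw [coe_smul_of_det_pos det_scaleGL_pos]
  simp [num, denom, coe_scaleGL]

theorem σ_scaleGL (w : ℂ) : σ (scaleGL ℝ a) w = w :=
  DFunLike.congr_fun (if_pos det_scaleGL_pos : _ = ContinuousAlgEquiv.refl ℝ ℂ) w

theorem slash_scaleGL (k : ℤ) (F : ℍ → ℂ) :
    F ∣[k] scaleGL ℝ a = (a : ℂ) ^ (k - 1) • dilate a F := by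
  ext τ
  rw [ModularForm.slash_apply, det_scaleGL, σ_scaleGL]
  simp [denom, coe_scaleGL, mul_comm, dilate]

theorem HasQExpansion.dilate {F : ℍ → ℂ} {p : PowerSeries ℂ} (hF : HasQExpansion F p) :
    HasQExpansion (dilate a F) (p.expand a (NeZero.ne a)) := by
  intro τ
  have hq : Function.Periodic.qParam 1 ((scaleGL ℝ a • τ : ℍ) : ℂ) =
      Function.Periodic.qParam 1 τ ^ a := by
    rw [coe_scaleGL_smul, Function.Periodic.qParam, Function.Periodic.qParam, ← exp_nat_mul]
    ring_nf
  have hsupp (n : ℕ) (hn : n ∉ Set.range (a * ·)) :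
      (p.expand a (NeZero.ne a)).coeff n * Function.Periodic.qParam 1 τ ^ n = 0 := by
    rw [PowerSeries.coeff_expand_of_not_dvd _ _ _ fun ⟨m, hm⟩ ↦ hn ⟨m, hm.symm⟩, zero_mul]
  refine ((mul_right_injective₀ (NeZero.ne a)).hasSum_iff hsupp).mp ?_
  simpa only [Function.comp_def, PowerSeries.coeff_expand_mul, pow_mul, hq] using!
    hF (scaleGL ℝ a • τ)

theorem isBoundedAtImInfty_slash_scaleGL {k : ℤ} {F : ℍ → ℂ}
    (hF : ∀ γ : SL(2, ℤ), IsBoundedAtImInfty (F ∣[k] γ)) (γ : SL(2, ℤ)) :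
    IsBoundedAtImInfty ((F ∣[k] scaleGL ℝ a) ∣[k] γ) := by
  have hrat : (scaleGL ℚ a * SpecialLinearGroup.mapGL ℚ γ).map (Rat.castHom ℝ) =
      scaleGL ℝ a * SpecialLinearGroup.mapGL ℝ γ := by
    ext i j
    fin_cases i <;> fin_cases j <;> simp [coe_scaleGL, Matrix.mul_apply]
  have h := isBoundedAtImInfty_slash_map_ratCast hF (scaleGL ℚ a * SpecialLinearGroup.mapGL ℚ γ)
  rwa [hrat, SlashAction.slash_mul] at h

theorem exists_scaleGL_mul_eq {N : ℕ} {γ : SL(2, ℤ)} (hγ : γ ∈ Gamma0 (a * N)) :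
    ∃ δ ∈ Gamma0 N,
      scaleGL ℝ a * SpecialLinearGroup.mapGL ℝ γ = SpecialLinearGroup.mapGL ℝ δ * scaleGL ℝ a := by
  rw [Gamma0_mem, ZMod.intCast_zmod_eq_zero_iff_dvd] at hγ
  obtain ⟨m, hm⟩ := hγ
  have hdet := γ.det_coe
  rw [det_fin_two, hm] at hdet
  obtain ⟨δ, hδ⟩ : ∃ δ : SL(2, ℤ), δ.1 = !![γ 0 0, a * γ 0 1; N * m, γ 1 1] := by
    refine ⟨⟨_, ?_⟩, rfl⟩
    rw [det_fin_two_of]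
    push_cast at hdet
    linarith
  refine ⟨δ, ?_, ?_⟩
  · rw [Gamma0_mem, ZMod.intCast_zmod_eq_zero_iff_dvd, hδ]
    exact dvd_mul_right _ _
  · ext i j
    fin_cases i <;> fin_cases j <;>
      simp [coe_scaleGL, Matrix.mul_apply, hδ, hm, mul_comm, mul_left_comm]

theorem slash_scaleGL_slash_of_mul_eq {γ δ : SL(2, ℤ)}
    (h : scaleGL ℝ a * SpecialLinearGroup.mapGL ℝ γ = SpecialLinearGroup.mapGL ℝ δ * scaleGL ℝ a)
    (k : ℤ) (F : ℍ → ℂ) :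
    (F ∣[k] scaleGL ℝ a) ∣[k] γ = (F ∣[k] δ) ∣[k] scaleGL ℝ a := by
  rw [ModularForm.SL_slash, ModularForm.SL_slash, ← SlashAction.slash_mul,
    ← SlashAction.slash_mul]
  exact congrArg (F ∣[k] ·) h

theorem IsModularForm.dilate {N : ℕ} {k : ℤ} {F : ℍ → ℂ} (hF : IsModularForm (Gamma0 N) k F) :
    IsModularForm (Gamma0 (a * N)) k (dilate a F) := by
  have hslash : IsModularForm (Gamma0 (a * N)) k (F ∣[k] scaleGL ℝ a) := by
    refine ⟨hF.holo.slash k _, fun γ hγ ↦ ?_, isBoundedAtImInfty_slash_scaleGL hF.bdd⟩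
    obtain ⟨δ, hδ, h⟩ := exists_scaleGL_mul_eq hγ
    rw [slash_scaleGL_slash_of_mul_eq h, hF.slash_eq δ hδ]
  have ha : (a : ℂ) ^ (k - 1) ≠ 0 := zpow_ne_zero _ (Nat.cast_ne_zero.mpr (NeZero.ne a))
  simpa only [slash_scaleGL, inv_smul_smul₀ ha] using hslash.const_smul ((a : ℂ) ^ (k - 1))⁻¹

end Dilation

end ModularForms

section QuasiModular

open UpperHalfPlane hiding I
open Complex Derivative Matrix CongruenceSubgroup EisensteinSeries
open scoped Manifold Real ModularForm

theorem E2_slash_eq_add (γ : SL(2, ℤ)) :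
    E2 ∣[(2 : ℤ)] γ = E2 + (12 * ((2 * π * I) ^ 2)⁻¹ : ℂ) • D2 γ := by
  have hπ : (π : ℂ) ≠ 0 := ofReal_ne_zero.mpr Real.pi_ne_zero
  ext z
  rw [E2_slash_action, riemannZeta_two]
  simp only [Pi.sub_apply, Pi.add_apply, Pi.smul_apply, smul_eq_mul, mul_pow, I_sq]
  field

theorem isBoundedAtImInfty_D2 (γ : SL(2, ℤ)) : IsBoundedAtImInfty (D2 γ) := by
  rw [isBoundedAtImInfty_iff]
  refine ⟨‖(2 * π * I : ℂ)‖, 1, fun z hz ↦ ?_⟩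
  have hγ : ‖((γ 1 0 : ℤ) : ℂ)‖ ≤ ‖denom γ z‖ :=
    calc ‖((γ 1 0 : ℤ) : ℂ)‖ = |((γ 1 0 : ℤ) : ℝ)| * 1 := by simp
      _ ≤ |((γ 1 0 : ℤ) : ℝ)| * z.im := by gcongr
      _ = |(denom γ z).im| := by simp [ModularGroup.denom_apply, abs_mul, abs_of_pos z.im_pos]
      _ ≤ ‖denom γ z‖ := abs_im_le_norm _
  rw [D2, norm_div, norm_mul, div_le_iff₀ (norm_pos_iff.mpr (denom_ne_zero _ z))]
  gcongr

theorem hasDerivAt_D2 (γ : SL(2, ℤ)) (z : ℍ) :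
    HasDerivAt (D2 γ ∘ ofComplex) (-(2 * π * I)⁻¹ * D2 γ z ^ 2) z := by
  have hdenom : HasDerivAt (fun w : ℂ ↦ denom γ w) (γ 1 0 : ℂ) (z : ℂ) := by
    simpa [denom] using ((hasDerivAt_id (z : ℂ)).const_mul (γ 1 0 : ℂ)).add_const (γ 1 1 : ℂ)
  have hz : denom γ z ≠ 0 := denom_ne_zero _ z
  refine (((hasDerivAt_const _ (2 * π * I * γ 1 0)).div hdenom hz).congr_of_eventuallyEq
    ?_).congr_deriv ?_
  · filter_upwards [isOpen_upperHalfPlaneSet.mem_nhds z.im_pos] with w hw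
    simp [D2, ofComplex_apply_of_im_pos hw]
  · rw [D2]
    field_simp [two_pi_I_ne_zero]
    ring

theorem mdifferentiable_D2 (γ : SL(2, ℤ)) : MDiff (D2 γ) := fun z ↦
  mdifferentiableAt_iff.mpr (hasDerivAt_D2 γ z).differentiableAt

theorem normalizedDeriv_D2 (γ : SL(2, ℤ)) :
    D (D2 γ) = (-((2 * π * I) ^ 2)⁻¹ : ℂ) • D2 γ ^ 2 := by
  ext z
  rw [normalizedDerivOfComplex, (hasDerivAt_D2 γ z).deriv, Pi.smul_apply, Pi.pow_apply, smul_eq_mul]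
  ring

theorem D2_slash_scaleGL {a : ℕ} [NeZero a] {γ δ : SL(2, ℤ)}
    (h : scaleGL ℝ a * SpecialLinearGroup.mapGL ℝ γ = SpecialLinearGroup.mapGL ℝ δ * scaleGL ℝ a) :
    D2 δ ∣[(2 : ℤ)] scaleGL ℝ a = D2 γ := by
  have hentry (j : Fin 2) := congrArg (fun g : GL (Fin 2) ℝ ↦ (g 1 j : ℂ)) h
  have h0 : (γ 1 0 : ℂ) = a * δ 1 0 := by
    simpa [coe_scaleGL, Matrix.mul_apply, mul_comm] using hentry 0
  have h1 : (γ 1 1 : ℂ) = δ 1 1 := by simpa [coe_scaleGL, Matrix.mul_apply] using hentry 1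
  ext z
  rw [slash_scaleGL, Pi.smul_apply, dilate, D2, D2, ModularGroup.denom_apply,
    ModularGroup.denom_apply, coe_scaleGL_smul, h0, h1, smul_eq_mul,
    show (2 : ℤ) - 1 = 1 from rfl, zpow_one]
  ring

theorem isBoundedAtImInfty_E2_slash (γ : SL(2, ℤ)) : IsBoundedAtImInfty (E2 ∣[(2 : ℤ)] γ) := by
  rw [E2_slash_eq_add]
  exact isBoundedAtImInfty_E2.add ((isBoundedAtImInfty_D2 γ).const_smul_left _)

/-- Slashing `a E₂(a z)` by `γ ∈ Γ₀(a)` produces the same multiple of `D2 γ` as slashing `E₂`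
does, so the failures of modularity cancel. -/
theorem isModularForm_dilate_E2_sub (a : ℕ) [NeZero a] :
    IsModularForm (Gamma0 a) 2 ((a : ℂ) • dilate a E2 + (-1 : ℂ) • E2) := by
  have hslash : E2 ∣[(2 : ℤ)] scaleGL ℝ a = (a : ℂ) • dilate a E2 := by
    simp [slash_scaleGL]
  rw [← hslash]
  refine ⟨(E2_mdifferentiable.slash 2 _).add (E2_mdifferentiable.const_smul _),
    fun γ hγ ↦ ?_, fun γ ↦ ?_⟩
  · obtain ⟨δ, -, h⟩ := exists_scaleGL_mul_eq (N := 1) (by rwa [mul_one])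
    rw [SlashAction.add_slash, ModularForm.SL_smul_slash, slash_scaleGL_slash_of_mul_eq h,
      E2_slash_eq_add, E2_slash_eq_add, SlashAction.add_slash,
      ModularForm.smul_slash, D2_slash_scaleGL h, σ_scaleGL]
    module
  · rw [SlashAction.add_slash, ModularForm.SL_smul_slash]
    exact (isBoundedAtImInfty_slash_scaleGL isBoundedAtImInfty_E2_slash γ).add
      ((isBoundedAtImInfty_E2_slash γ).const_smul_left _)

theorem serreDerivative_one_E2_slash (γ : SL(2, ℤ)) :
    serreDerivative 1 E2 ∣[(4 : ℤ)] γ = serreDerivative 1 E2 := by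
  have hD := normalizedDerivOfComplex_SL_slash (k := 2) E2_mdifferentiable (γ := γ)
  rw [E2_slash_eq_add, normalizedDerivOfComplex_add _ _ E2_mdifferentiable
    ((mdifferentiable_D2 γ).const_smul _), normalizedDerivOfComplex_smul _ _ (mdifferentiable_D2 γ),
    normalizedDeriv_D2] at hD
  have hmul : (E2 * E2) ∣[(4 : ℤ)] γ = E2 ∣[(2 : ℤ)] γ * E2 ∣[(2 : ℤ)] γ :=
    ModularForm.mul_slash_SL2 2 2 γ E2 E2
  rw [serreDerivative_eq_add_smul, SlashAction.add_slash, ModularForm.SL_smul_slash, hmul,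
    E2_slash_eq_add]
  ext z
  have hDz := congrFun hD z
  have hD2 : (γ 1 0 / denom γ z : ℂ) = (2 * π * I)⁻¹ * D2 γ z := by
    rw [D2]
    field_simp [two_pi_I_ne_zero]
  simp only [Pi.sub_apply, Pi.add_apply, Pi.smul_apply, Pi.mul_apply, Pi.pow_apply, smul_eq_mul,
    hD2, show (2 : ℤ) + 2 = 4 from rfl] at hDz ⊢
  push_cast at hDz
  linear_combination -hDz

theorem isModularForm_serreDerivative_one_E2 (Γ : Subgroup SL(2, ℤ)) :
    IsModularForm Γ 4 (serreDerivative 1 E2) where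
  holo := serreDerivative_mdifferentiable _ E2_mdifferentiable
  slash_eq γ _ := serreDerivative_one_E2_slash γ
  bdd γ := by
    rw [serreDerivative_one_E2_slash]
    exact isBoundedAtImInfty_serreDerivative _ E2_mdifferentiable isBoundedAtImInfty_E2

/-- The first Rankin–Cohen bracket of functions `F` of weight `k` and `G` of weight `l`. -/
noncomputable def rankinCohenBracket (k l : ℤ) (F G : ℍ → ℂ) : ℍ → ℂ :=
  (k : ℂ) • (F * D G) + (-l : ℂ) • (D F * G)

/-- The second order operator of Kaneko and Zagier, up to a factor `12`; it raises the weight `k`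
by `4`. -/
noncomputable def kanekoZagier (k : ℤ) (F : ℍ → ℂ) : ℍ → ℂ :=
  (12 : ℂ) • D (D F) + (-(2 * (k + 1)) : ℂ) • (E2 * D F) + (k * (k + 1) : ℂ) • (D E2 * F)

namespace IsModularForm

variable {Γ : Subgroup SL(2, ℤ)} {k l : ℤ} {F G : ℍ → ℂ}

theorem rankinCohenBracket (hF : IsModularForm Γ k F) (hG : IsModularForm Γ l G) :
    IsModularForm Γ (k + l + 2) (rankinCohenBracket k l F G) := by
  have h₁ := (hF.mul hG.serreDerivative).const_smul k
  have h₂ := (hF.serreDerivative.mul hG).const_smul (-l)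
  rw [← add_assoc] at h₁
  rw [add_right_comm] at h₂
  convert! h₁.add h₂ using 1
  ext z
  simp only [_root_.rankinCohenBracket, Pi.add_apply, Pi.smul_apply, Pi.mul_apply, smul_eq_mul,
    serreDerivative_apply]
  ring

/-- With `∂ₖ` the Serre derivative, the operator is `12 ∂ₖ₊₂ ∂ₖ + k (k + 2) ∂₁E₂`. -/
theorem kanekoZagier (hF : IsModularForm Γ k F) :
    IsModularForm Γ (k + 4) (kanekoZagier k F) := by
  have h₁ := hF.serreDerivative.serreDerivative.const_smul 12
  have h₂ := ((isModularForm_serreDerivative_one_E2 Γ).mul hF).const_smul (k * (k + 2))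
  rw [add_assoc] at h₁
  rw [add_comm] at h₂
  convert! h₁.add h₂ using 1
  have hE2F := E2_mdifferentiable.mul hF.holo
  have hD : D (Derivative.serreDerivative k F) =
      D (D F) + (-(k * 12⁻¹) : ℂ) • (D E2 * F + E2 * D F) := by
    rw [serreDerivative_eq_add_smul, normalizedDerivOfComplex_add _ _
      (normalizedDerivOfComplex_mdifferentiable hF.holo) (hE2F.const_smul _),
      normalizedDerivOfComplex_smul _ _ hE2F,
      normalizedDerivOfComplex_mul _ _ E2_mdifferentiable hF.holo]
  rw [serreDerivative_eq_add_smul ((k + 2 : ℤ) : ℂ), hD]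
  ext z
  simp only [_root_.kanekoZagier, Pi.add_apply, Pi.smul_apply, Pi.mul_apply, smul_eq_mul,
    serreDerivative_apply]
  push_cast
  ring

end IsModularForm

variable {Γ : Subgroup SL(2, ℤ)} {k : ℤ} {φ g : ℍ → ℂ}

theorem isModularForm_mul_sub_normalizedDeriv (hk : k ≠ 0)
    (hφ : IsModularForm Γ 2 (φ + (-1 : ℂ) • E2)) (hg : IsModularForm Γ k g) :
    IsModularForm Γ (k + 2) (φ * g + (-(12 / k) : ℂ) • D g) := by
  have h₁ := hφ.mul hg
  have h₂ := hg.serreDerivative.const_smul (-(12 / k))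
  rw [add_comm] at h₁
  convert! h₁.add h₂ using 1
  ext z
  have hk' : (k : ℂ) ≠ 0 := Int.cast_ne_zero.mpr hk
  simp only [Pi.add_apply, Pi.smul_apply, Pi.mul_apply, smul_eq_mul, serreDerivative_apply]
  field

theorem isModularForm_normalizedDeriv_mul_sub
    (hφ : IsModularForm Γ 2 (φ + (-1 : ℂ) • E2)) (hg : IsModularForm Γ k g) :
    IsModularForm Γ (k + 4) (((k + 1) * (k + 2) : ℂ) • (D φ * g) +
      (-(2 * (k + 1)) : ℂ) • D (φ * g) + (12 : ℂ) • D (D g)) := by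
  have h₁ := (hφ.rankinCohenBracket hg).const_smul (-(k + 1))
  have h₂ := hg.kanekoZagier
  rw [show 2 + k + 2 = k + 4 by ring] at h₁
  convert! h₁.add h₂ using 1
  have hφ₀ : MDiff φ := by simpa using hφ.holo.add E2_mdifferentiable
  have hD : D (φ + (-1 : ℂ) • E2) = D φ + (-1 : ℂ) • D E2 := by
    rw [normalizedDerivOfComplex_add _ _ hφ₀ (E2_mdifferentiable.const_smul _),
      normalizedDerivOfComplex_smul _ _ E2_mdifferentiable]
  rw [rankinCohenBracket, kanekoZagier, hD, normalizedDerivOfComplex_mul _ _ hφ₀ hg.holo]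
  ext z
  simp only [Pi.add_apply, Pi.smul_apply, Pi.mul_apply, smul_eq_mul]
  push_cast
  ring

end QuasiModular

section Coefficients

open PowerSeries

theorem coeff_expand_mul_expand {R : Type*} [CommRing R] {p q : R⟦X⟧}
    (hp : p.constantCoeff = 0) (hq : q.constantCoeff = 0) {a b : ℕ} (ha : a ≠ 0) (hb : b ≠ 0)
    (n : ℕ) :
    (p.expand a ha * q.expand b hb).coeff n =
      ∑ lm ∈ convPairs a b n, p.coeff lm.1 * q.coeff lm.2 := by
  rw [coeff_mul]
  symm
  refine Finset.sum_of_injOn (fun lm ↦ (a * lm.1, b * lm.2))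
    ((mul_right_injective₀ ha).prodMap (mul_right_injective₀ hb)).injOn ?_ ?_ ?_
  · intro lm hlm
    simpa using ((mem_convPairs ha.bot_lt hb.bot_lt lm).mp hlm).2.2
  · rintro ⟨i, j⟩ hij hne
    by_cases hai : a ∣ i
    swap
    · rw [coeff_expand_of_not_dvd _ _ _ hai, zero_mul]
    by_cases hbj : b ∣ j
    swap
    · rw [coeff_expand_of_not_dvd _ _ _ hbj, mul_zero]
    obtain ⟨l, rfl⟩ := hai
    obtain ⟨m, rfl⟩ := hbj
    rcases Nat.eq_zero_or_pos l with rfl | hl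
    · simp [hp]
    rcases Nat.eq_zero_or_pos m with rfl | hm
    · simp [hq]
    exact absurd ⟨(l, m), (mem_convPairs ha.bot_lt hb.bot_lt _).mpr
      ⟨hl, hm, Finset.HasAntidiagonal.mem_antidiagonal.mp hij⟩, rfl⟩ hne
  · intro lm _
    simp only [coeff_expand_mul]

theorem X_mul_derivative_expand {a : ℕ} (ha : a ≠ 0) (p : ℂ⟦X⟧) :
    X * d⁄dX ℂ (p.expand a ha) = (a : ℂ) • (X * d⁄dX ℂ p).expand a ha := by
  ext n
  rw [coeff_X_mul_derivative, coeff_smul]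
  by_cases han : a ∣ n
  · obtain ⟨m, rfl⟩ := han
    rw [coeff_expand_mul, coeff_expand_mul, coeff_X_mul_derivative]
    push_cast
    rw [smul_eq_mul, mul_assoc]
  · rw [coeff_expand_of_not_dvd _ _ _ han, coeff_expand_of_not_dvd _ _ _ han, mul_zero,
      smul_zero]

theorem coeff_one_add_smul_mul_one_add_smul {R : Type*} [CommRing R] (u t : R) (p q : R⟦X⟧)
    {n : ℕ} (hn : n ≠ 0) :
    ((1 + u • p) * (1 + t • q)).coeff n =
      u * p.coeff n + t * q.coeff n + u * t * (p * q).coeff n := by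
  have h : (1 + u • p) * (1 + t • q) = 1 + u • p + t • q + (u * t) • (p * q) := by
    simp only [smul_eq_C_mul, map_mul]
    ring
  simp [h, coeff_one, hn]

theorem coeff_derivative_one_add_smul_mul_one_add_smul (u t : ℂ) (p q : ℂ⟦X⟧) (n : ℕ) :
    ((X * d⁄dX ℂ (1 + u • p)) * (1 + t • q)).coeff n =
      u * (n * p.coeff n) + u * t * ((X * d⁄dX ℂ p) * q).coeff n := by
  have h : (X * d⁄dX ℂ (1 + u • p)) * (1 + t • q) =
      u • (X * d⁄dX ℂ p) + (u * t) • ((X * d⁄dX ℂ p) * q) := by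
    rw [map_add, (d⁄dX ℂ).map_one_eq_zero, (d⁄dX ℂ).map_smul]
    simp only [smul_eq_C_mul, map_mul]
    ring
  rw [h]
  simp [coeff_X_mul_derivative]

/-- The generating function `∑ σ_r(n) qⁿ` of the divisor sums, over `n ≥ 1`. -/
noncomputable def sigmaSeries (r : ℕ) : ℂ⟦X⟧ := .mk fun n ↦ (ArithmeticFunction.sigma r n : ℂ)

variable {a b : ℕ}

theorem constantCoeff_sigmaSeries (r : ℕ) : (sigmaSeries r).constantCoeff = 0 := by
  simp [sigmaSeries, ← coeff_zero_eq_constantCoeff_apply]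

theorem coeff_expand_sigmaSeries (ha : a ≠ 0) (r n : ℕ) :
    ((sigmaSeries r).expand a ha).coeff n = sigmaDiv r n a := by
  rw [sigmaDiv]
  split_ifs with han
  · obtain ⟨m, rfl⟩ := han
    rw [coeff_expand_mul, sigmaSeries, coeff_mk, Nat.mul_div_cancel_left _ ha.bot_lt]
  · rw [coeff_expand_of_not_dvd _ _ _ han, Nat.cast_zero]

theorem coeff_expand_sigmaSeries_mul_expand_sigmaSeries (ha : a ≠ 0) (hb : b ≠ 0) (r s n : ℕ) :
    ((sigmaSeries r).expand a ha * (sigmaSeries s).expand b hb).coeff n =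
      (convW a b r s n : ℂ) := by
  rw [coeff_expand_mul_expand (constantCoeff_sigmaSeries r) (constantCoeff_sigmaSeries s)]
  simp [convW, sigmaSeries]

theorem coeff_derivative_expand_sigmaSeries_mul_expand_sigmaSeries (ha : a ≠ 0) (hb : b ≠ 0)
    (r s n : ℕ) :
    ((X * d⁄dX ℂ ((sigmaSeries r).expand a ha)) * (sigmaSeries s).expand b hb).coeff n =
      (a * convWPow a b 1 r s n : ℂ) := by
  rw [X_mul_derivative_expand, smul_mul_assoc, coeff_smul, coeff_expand_mul_expand (by simp)
    (constantCoeff_sigmaSeries s)]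
  simp [convWPow, coeff_X_mul_derivative, sigmaSeries]

end Coefficients

section Fourier

open PowerSeries UpperHalfPlane

theorem hasQExpansion_qExpansion {Γ : Subgroup (GL (Fin 2) ℝ)} {k : ℤ}
    (hΓ : (1 : ℝ) ∈ Γ.strictPeriods) (f : ModularForm Γ k) :
    HasQExpansion f (qExpansion 1 f) := fun τ ↦ by
  have : Fact (IsCusp OnePoint.infty Γ) := ⟨Subgroup.isCusp_of_mem_strictPeriods one_pos hΓ⟩
  exact ModularForm.hasSum_qExpansion _ one_pos hΓ τ

theorem modFormCoeff_eq_sum_repr_mul {N : ℕ} {k : ℤ} {ι : Type*} [Fintype ι]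
    (v : Module.Basis ι ℂ (ModForms k N)) (f : ModForms k N) (n : ℕ) :
    modFormCoeff f n = ∑ i, v.repr f i * modFormCoeff (v i) n := by
  have hΓ : (1 : ℝ) ∈ (CongruenceSubgroup.Gamma0 N : Subgroup (GL (Fin 2) ℝ)).strictPeriods := by
    simp
  have hsum := congrArg (fun F ↦ (ModularForm.qExpansionAddHom one_pos hΓ k F).coeff n)
    (v.sum_repr f)
  simp only [map_sum] at hsum
  refine hsum.symm.trans (Finset.sum_congr rfl fun i _ ↦ ?_)
  exact congrArg (coeff n) (ModularForm.qExpansion_smul one_pos hΓ (v.repr f i) (v i))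

theorem IsModularForm.modFormCoeff_toModularForm {N : ℕ} [NeZero N] {k : ℤ} {F : ℍ → ℂ} {p : ℂ⟦X⟧}
    (hF : IsModularForm (CongruenceSubgroup.Gamma0 N) k F) (hp : HasQExpansion F p) (n : ℕ) :
    modFormCoeff hF.toModularForm n = p.coeff n :=
  (ModularFormClass.qExpansion_coeff_unique one_pos (by simp) (f := hF.toModularForm) hp n).symm

theorem hasQExpansion_E2 : HasQExpansion EisensteinSeries.E2 (1 + (-24 : ℂ) • sigmaSeries 1) :=
  fun τ ↦ by
  convert! EisensteinSeries.hasSum_qExpansion_E2 (z := τ) using 2 with n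
  rcases eq_or_ne n 0 with rfl | hn
  · simp [constantCoeff_sigmaSeries]
  · simp [Function.Periodic.qParam, sigmaSeries, coeff_one, hn]

theorem hasQExpansion_E {k : ℕ} (hk : 3 ≤ k) (hk2 : Even k) :
    HasQExpansion (ModularForm.E hk) (1 + (-(2 * k / bernoulli k) : ℂ) • sigmaSeries (k - 1)) := by
  convert! hasQExpansion_qExpansion (by simp) (ModularForm.E hk)
  ext n
  rw [EisensteinSeries.E_qExpansion_coeff hk hk2]
  rcases eq_or_ne n 0 with rfl | hn
  · simp [constantCoeff_sigmaSeries]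
  · simp [sigmaSeries, coeff_one, hn]

theorem bernoulli_ne_zero_of_even {k : ℕ} (hk : k ≠ 0) (hk2 : Even k) : bernoulli k ≠ 0 := by
  obtain ⟨m, rfl⟩ := even_iff_exists_two_mul.mp hk2
  have hm : m ≠ 0 := right_ne_zero_of_mul hk
  have hζ : riemannZeta (2 * m) ≠ 0 := by
    refine riemannZeta_ne_zero_of_one_le_re ?_
    have : 1 ≤ 2 * m := by lia
    simpa using (mod_cast this : (1 : ℝ) ≤ 2 * m)
  intro hB
  rw [riemannZeta_two_mul_nat hm, hB] at hζ
  simp at hζ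

end Fourier

section Convolution

open CongruenceSubgroup EisensteinSeries PowerSeries

variable {N a b k : ℕ}

theorem isModularForm_dilate_E2_sub_of_dvd [NeZero a] (ha : a ∣ N) :
    IsModularForm (Gamma0 N) 2 ((a : ℂ) • dilate a E2 + (-1 : ℂ) • E2) :=
  (isModularForm_dilate_E2_sub a).mono (Gamma0_le_of_dvd ha)

theorem isModularForm_dilate_E [NeZero b] (hb : b ∣ N) (hk : 3 ≤ k) :
    IsModularForm (Gamma0 N) k (dilate b (ModularForm.E hk)) :=
  (IsModularForm.of_levelOne (Γ := Gamma0 1) (ModularForm.E hk)).dilate.mono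
    (Gamma0_le_of_dvd (by rwa [mul_one]))

theorem hasQExpansion_smul_dilate_E2 [NeZero a] : HasQExpansion ((a : ℂ) • dilate a E2)
    ((a : ℂ) • (1 + (-24 : ℂ) • (sigmaSeries 1).expand a (NeZero.ne a))) := by
  simpa only [map_add, map_one, map_smul] using (hasQExpansion_E2.dilate (a := a)).const_smul a

theorem hasQExpansion_dilate_E [NeZero b] (hk : 3 ≤ k) (hk2 : Even k) :
    HasQExpansion (dilate b (ModularForm.E hk))
      (1 + (-(2 * k / bernoulli k) : ℂ) • (sigmaSeries (k - 1)).expand b (NeZero.ne b)) := by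
  simpa only [map_add, map_one, map_smul] using (hasQExpansion_E hk hk2).dilate (a := b)

theorem exists_modForm_convW_eq [NeZero N] (hk : 3 ≤ k) (hk2 : Even k) (ha : a ∣ N) (hb : b ∣ N) :
    ∃ F : ModForms (k + 2) N, ∀ n : ℕ, 1 ≤ n →
      (convW a b 1 (k - 1) n : ℂ) =
        (bernoulli k : ℂ) / (2 * k) * sigmaDiv 1 n a
          + (1 / 24 - (n : ℂ) / (2 * k * a)) * sigmaDiv (k - 1) n b
          - (bernoulli k : ℂ) / (4 * a * (k : ℂ) ^ 2) * modFormCoeff F n := by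
  have : NeZero a := ⟨ne_zero_of_dvd_ne_zero (NeZero.ne N) ha⟩
  have : NeZero b := ⟨ne_zero_of_dvd_ne_zero (NeZero.ne N) hb⟩
  have hform := (isModularForm_mul_sub_normalizedDeriv (by lia)
    (isModularForm_dilate_E2_sub_of_dvd ha) (isModularForm_dilate_E hb hk)).const_smul (-(k / 12))
  have qφ := hasQExpansion_smul_dilate_E2 (a := a)
  have qg := hasQExpansion_dilate_E (b := b) hk hk2
  refine ⟨hform.toModularForm, fun n hn ↦ ?_⟩
  rw [hform.modFormCoeff_toModularForm
    (((qφ.mul qg).add (qg.normalizedDeriv.const_smul _)).const_smul _)]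
  have hB : (bernoulli k : ℂ) ≠ 0 := mod_cast bernoulli_ne_zero_of_even (by lia) hk2
  have hkC : (k : ℂ) ≠ 0 := Nat.cast_ne_zero.mpr (by lia)
  have haC : (a : ℂ) ≠ 0 := Nat.cast_ne_zero.mpr (NeZero.ne a)
  have hn0 : n ≠ 0 := by lia
  simp only [LinearMap.map_add, coeff_smul, smul_mul_assoc, coeff_X_mul_derivative, coeff_one, hn0,
    if_false, coeff_one_add_smul_mul_one_add_smul _ _ _ _ hn0, coeff_expand_sigmaSeries,
    coeff_expand_sigmaSeries_mul_expand_sigmaSeries, smul_eq_mul]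
  push_cast
  field

theorem exists_modForm_convWPow_eq [NeZero N] (hk : 3 ≤ k) (hk2 : Even k) (ha : a ∣ N)
    (hb : b ∣ N) :
    ∃ F : ModForms (k + 4) N, ∀ n : ℕ, 1 ≤ n →
      (convWPow a b 1 1 (k - 1) n : ℂ) =
        (6 * (n : ℂ) ^ 2 - a * (k + 1) * n) / (12 * (a : ℂ) ^ 2 * (k + 1) * (k + 2))
            * sigmaDiv (k - 1) n b
          + (bernoulli k : ℂ) / (2 * a * (k + 2)) * n * sigmaDiv 1 n a
          + 2 * n / (a * (k + 2)) * convW a b 1 (k - 1) n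
          + (bernoulli k : ℂ) / (4 * (a : ℂ) ^ 2 * k * (k + 1) * (k + 2)) * modFormCoeff F n := by
  have : NeZero a := ⟨ne_zero_of_dvd_ne_zero (NeZero.ne N) ha⟩
  have : NeZero b := ⟨ne_zero_of_dvd_ne_zero (NeZero.ne N) hb⟩
  have hform := (isModularForm_normalizedDeriv_mul_sub
    (isModularForm_dilate_E2_sub_of_dvd ha) (isModularForm_dilate_E hb hk)).const_smul 12⁻¹
  have qφ := hasQExpansion_smul_dilate_E2 (a := a)
  have qg := hasQExpansion_dilate_E (b := b) hk hk2
  refine ⟨hform.toModularForm, fun n hn ↦ ?_⟩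
  rw [hform.modFormCoeff_toModularForm
    (((((qφ.normalizedDeriv.mul qg).const_smul _).add
      ((qφ.mul qg).normalizedDeriv.const_smul _)).add
        (qg.normalizedDeriv.normalizedDeriv.const_smul _)).const_smul _)]
  have hB : (bernoulli k : ℂ) ≠ 0 := mod_cast bernoulli_ne_zero_of_even (by lia) hk2
  have hkC : (k : ℂ) ≠ 0 := Nat.cast_ne_zero.mpr (by lia)
  have hk1C : (k + 1 : ℂ) ≠ 0 := mod_cast k.succ_ne_zero
  have hk2C : (k + 2 : ℂ) ≠ 0 := mod_cast (k + 1).succ_ne_zero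
  have haC : (a : ℂ) ≠ 0 := Nat.cast_ne_zero.mpr (NeZero.ne a)
  have hn0 : n ≠ 0 := by lia
  simp only [LinearMap.map_add, coeff_smul, smul_mul_assoc, coeff_X_mul_derivative, coeff_one, hn0,
    if_false, Derivation.map_smul, mul_smul_comm, coeff_one_add_smul_mul_one_add_smul _ _ _ _ hn0,
    coeff_derivative_one_add_smul_mul_one_add_smul, coeff_expand_sigmaSeries,
    coeff_derivative_expand_sigmaSeries_mul_expand_sigmaSeries,
    coeff_expand_sigmaSeries_mul_expand_sigmaSeries, smul_eq_mul]
  push_cast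
  field

end Convolution

theorem theorem3p1_general {N a b k : ℕ} [NeZero N] (hk : 4 ≤ k) (hk2 : Even k) (ha : a ∣ N)
    (hb : b ∣ N) {ι κ : Type*} [Fintype ι] [Fintype κ]
    (f : Module.Basis ι ℂ (ModForms (k + 2) N)) (h : Module.Basis κ ℂ (ModForms (k + 4) N)) :
    (∃ γ : κ → ℂ, ∀ n : ℕ, 1 ≤ n →
      (convWPow a b 1 1 (k - 1) n : ℂ) =
        (6 * (n : ℂ) ^ 2 - a * (k + 1) * n) / (12 * (a : ℂ) ^ 2 * (k + 1) * (k + 2))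
            * sigmaDiv (k - 1) n b
          + (bernoulli k : ℂ) / (2 * a * (k + 2)) * n * sigmaDiv 1 n a
          + 2 * n / (a * (k + 2)) * convW a b 1 (k - 1) n
          + (bernoulli k : ℂ) / (4 * (a : ℂ) ^ 2 * k * (k + 1) * (k + 2))
            * ∑ i, γ i * modFormCoeff (h i) n) ∧
    (∃ α : ι → ℂ, ∀ n : ℕ, 1 ≤ n →
      (convW a b 1 (k - 1) n : ℂ) =
        (bernoulli k : ℂ) / (2 * k) * sigmaDiv 1 n a
          + (1 / 24 - (n : ℂ) / (2 * k * a)) * sigmaDiv (k - 1) n b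
          - (bernoulli k : ℂ) / (4 * a * (k : ℂ) ^ 2) * ∑ i, α i * modFormCoeff (f i) n) := by
  have hk3 : 3 ≤ k := by lia
  obtain ⟨H, hH⟩ := exists_modForm_convWPow_eq hk3 hk2 ha hb
  obtain ⟨F, hF⟩ := exists_modForm_convW_eq hk3 hk2 ha hb
  refine ⟨⟨h.repr H, fun n hn ↦ ?_⟩, ⟨f.repr F, fun n hn ↦ ?_⟩⟩
  · rw [← modFormCoeff_eq_sum_repr_mul, hH n hn]
  · rw [← modFormCoeff_eq_sum_repr_mul, hF n hn]

theorem theorem3p1 (k a b : ℕ) (hk : 4 ≤ k) (hkeven : Even k) (ha : 0 < a) (hb : 0 < b)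
    (hab : Nat.Coprime a b)
    (f : Module.Basis (Fin (dimModForms (k + 2) (a * b))) ℂ (ModForms (k + 2) (a * b)))
    (h : Module.Basis (Fin (dimModForms (k + 4) (a * b))) ℂ (ModForms (k + 4) (a * b))) :
    (∃ γ : Fin (dimModForms (k + 4) (a * b)) → ℂ, ∀ n : ℕ, 2 ≤ n →
      (convWPow a b 1 1 (k - 1) n : ℂ) =
        (6 * (n : ℂ) ^ 2 - a * (k + 1) * n) / (12 * (a : ℂ) ^ 2 * (k + 1) * (k + 2))
            * sigmaDiv (k - 1) n b
          + (bernoulli k : ℂ) / (2 * a * (k + 2)) * n * sigmaDiv 1 n a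
          + 2 * n / (a * (k + 2)) * convW a b 1 (k - 1) n
          + (bernoulli k : ℂ) / (4 * (a : ℂ) ^ 2 * k * (k + 1) * (k + 2))
            * ∑ i, γ i * modFormCoeff (h i) n) ∧
    (∃ α : Fin (dimModForms (k + 2) (a * b)) → ℂ, ∀ n : ℕ, 1 ≤ n →
      (convW a b 1 (k - 1) n : ℂ) =
        (bernoulli k : ℂ) / (2 * k) * sigmaDiv 1 n a
          + (1 / 24 - (n : ℂ) / (2 * k * a)) * sigmaDiv (k - 1) n b
          - (bernoulli k : ℂ) / (4 * a * (k : ℂ) ^ 2) * ∑ i, α i * modFormCoeff (f i) n) := by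
  have : NeZero (a * b) := ⟨(Nat.mul_pos ha hb).ne'⟩
  obtain ⟨⟨γ, hγ⟩, hα⟩ := theorem3p1_general hk hkeven (dvd_mul_right a b) (dvd_mul_left b a) f h
  exact ⟨⟨γ, fun n hn ↦ hγ n (one_le_two.trans hn)⟩, hα⟩
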